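/- Let $n$ be a nonnegative integer and let $\mathcal{H}^1$ denote the one-dimensional Hausdorff measure on $\mathbb{R}^n$ (with the Euclidean distance), normalized so that it equals length on line segments. For $x,y,z\in\mathbb{R}^n$ let $c(x,y,z)$ be the inverse of the radius of the circumcircle of the triangle $(x,y,z)$, with $c(x,y,z)=0$ if $x,y,z$ are collinear (in particular, if two of them coincide), and for a Borel set $A\subset\mathbb{R}^n$ put $$c^2(A)=\int_A\int_A\int_A c(x,y,z)^2\,d\mathcal{H}^1(x)\,d\mathcal{H}^1(y)\,d\mathcal{H}^1(z)\in[0,\infty].$$ **Proposition 1.1.** Let $E\subset\mathbb{R}^n$ be a Borel set with $0<\mathcal{H}^1(E)<\infty$ and $c^2(E)<\infty$. Then for every $\eta>0$ there exists a subset $F$ of $E$ such that 1. $F$ is compact; 2. $c^2(F)\le \eta\,\operatorname{diam}F$; 3. $\mathcal{H}^1(F)>\dfrac{\operatorname{diam}F}{40}$; 4. $\mathcal{H}^1(F\cap B(x,t))\le 3t$ for all $x\in F$ and all $t>0$, where $B(x,t)$ is the closed ball with center $x$ and radius $t$. -/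

import Mathlib

open MeasureTheory
open scoped ENNReal

noncomputable section

open Classical in
/-- The Menger curvature `c(x, y, z)` of three points of `ℝⁿ`: the inverse of the radius of the
circumcircle of the triangle `(x, y, z)`. For a degenerate triple (collinear points, the case of
two equal points included) it is `0`. -/
def mengerCurvature {n : ℕ} (x y z : EuclideanSpace ℝ (Fin n)) : ℝ :=
  if h : AffineIndependent ℝ ![x, y, z] then
    (Affine.Simplex.circumradius (⟨![x, y, z], h⟩ : Affine.Triangle ℝ (EuclideanSpace ℝ (Fin n))))⁻¹
  else 0

/-- `c²(E) = ∫∫∫_{E³} c(x, y, z)² dℋ¹(x) dℋ¹(y) dℋ¹(z)`, the square of the total Menger curvature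
of `E`, as an extended nonnegative number; `ℋ¹ = μH[1]` is the one-dimensional Hausdorff measure
on `ℝⁿ` with its Euclidean distance. -/
def totalMengerCurvatureSq {n : ℕ} (E : Set (EuclideanSpace ℝ (Fin n))) : ℝ≥0∞ :=
  ∫⁻ x in E, ∫⁻ y in E, ∫⁻ z in E,
    ENNReal.ofReal (mengerCurvature x y z ^ 2)
      ∂(Measure.hausdorffMeasure 1) ∂(Measure.hausdorffMeasure 1) ∂(Measure.hausdorffMeasure 1)

/-- A 1-set: a Borel set `E ⊆ ℝⁿ` with `0 < ℋ¹(E) < ∞`. -/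
structure IsOneSet {n : ℕ} (E : Set (EuclideanSpace ℝ (Fin n))) : Prop where
  measurableSet : MeasurableSet E
  hausdorffMeasure_pos : 0 < Measure.hausdorffMeasure 1 E
  hausdorffMeasure_lt_top : Measure.hausdorffMeasure 1 E < ∞

end

/-!
Almost every point of `E` has upper one-dimensional density at most `1` (a Besicovitch covering of
the points of larger density would be too cheap), and at almost every `x` the energy
`∫ y in B(x, δ) ∩ E, ∫ z in E, c(x, y, z)²` tends to `0` with `δ`, as the integral over a shrinking
ball of an integrable function. Hence on a subset of `E` of positive measure both the density and
the energy are controlled uniformly below some scale `δ`. By definition of the Hausdorff measure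
this subset has pieces of arbitrarily small diameter whose measure is almost as large as their
diameter. A compact piece `F` with `diam F < δ` is as required: its growth at scales beyond `δ` is
bounded by the growth at scale `diam F`, and `c²(F)` is at most the energy bound times the measure
of `F`.
-/

open Metric Set Filter Topology
open scoped NNReal

section MengerCurvature

variable {n : ℕ} {x y z : EuclideanSpace ℝ (Fin n)}

theorem mengerCurvature_of_collinear (h : Collinear ℝ {x, y, z}) : mengerCurvature x y z = 0 :=
  dif_neg fun hi => affineIndependent_iff_not_collinear_set.1 hi h

theorem mengerCurvature_of_eq_or_eq (h : x = y ∨ z = y) : mengerCurvature x y z = 0 :=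
  mengerCurvature_of_collinear <|
    EuclideanGeometry.collinear_iff_eq_or_eq_or_angle_eq_zero_or_angle_eq_pi.2 <|
      h.imp_right Or.inl

theorem mengerCurvature_eq_two_mul_sin_angle_div_dist (hxy : x ≠ y) (hzy : z ≠ y) :
    mengerCurvature x y z = 2 * Real.sin (EuclideanGeometry.angle x y z) / dist x z := by
  by_cases hcol : Collinear ℝ {x, y, z}
  · have hangle : EuclideanGeometry.angle x y z = 0 ∨ EuclideanGeometry.angle x y z = Real.pi := by
      simpa only [hxy, hzy, false_or] using
        EuclideanGeometry.collinear_iff_eq_or_eq_or_angle_eq_zero_or_angle_eq_pi.1 hcol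
    rw [mengerCurvature_of_collinear hcol]
    rcases hangle with h | h <;> simp [h]
  · have hind : AffineIndependent ℝ ![x, y, z] := affineIndependent_iff_not_collinear_set.2 hcol
    have law_of_sines := Affine.Triangle.dist_div_sin_angle_eq_two_mul_circumradius
      (⟨![x, y, z], hind⟩ : Affine.Triangle ℝ (EuclideanSpace ℝ (Fin n)))
      (i₁ := 0) (i₂ := 1) (i₃ := 2) (by decide) (by decide) (by decide)
    simp only [Matrix.cons_val] at law_of_sines
    rw [mengerCurvature, dif_pos hind, mul_div_assoc, ← inv_div (dist x z), law_of_sines, mul_inv,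
      mul_inv_cancel_left₀ two_ne_zero]

theorem measurable_mengerCurvature :
    Measurable fun p : EuclideanSpace ℝ (Fin n) × EuclideanSpace ℝ (Fin n) ×
      EuclideanSpace ℝ (Fin n) => mengerCurvature p.1 p.2.1 p.2.2 := by
  classical
  -- The case `x = y` is set apart because then the angle is `π / 2` by convention, and the formula
  -- would give `2 / dist x z` in place of `0`.
  have h_ite : ∀ x y z : EuclideanSpace ℝ (Fin n), mengerCurvature x y z =
      if x = y ∨ z = y then 0 else 2 * Real.sin (EuclideanGeometry.angle x y z) / dist x z := by
    intro x y z
    split_ifs with h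
    · exact mengerCurvature_of_eq_or_eq h
    · exact mengerCurvature_eq_two_mul_sin_angle_div_dist (fun hxy => h (.inl hxy))
        (fun hzy => h (.inr hzy))
  simp only [h_ite]
  refine Measurable.ite ?_ measurable_const ?_
  · exact (measurableSet_eq_fun (by fun_prop) (by fun_prop)).union
      (measurableSet_eq_fun (by fun_prop) (by fun_prop))
  · simp only [EuclideanGeometry.angle, InnerProductGeometry.angle, vsub_eq_sub]
    fun_prop

end MengerCurvature

section HausdorffDensity

section EMetricSpace

variable {X : Type*} [EMetricSpace X] [MeasurableSpace X] [BorelSpace X] {d : ℝ} {A : Set X}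

theorem hausdorffMeasure_le_of_forall_exists_cover {ι : Type*} {M : ℝ≥0∞}
    (h : ∀ δ > (0 : ℝ≥0∞), ∃ (t : Set ι) (U : ι → Set X), t.Countable ∧
      (∀ i ∈ t, ediam (U i) ≤ δ) ∧ μH[d] (A \ ⋃ i ∈ t, U i) = 0 ∧
      ∑' i : t, ediam (U i) ^ d ≤ M) :
    μH[d] A ≤ M := by
  choose t U ht hdiam hnull hsum using fun k : ℕ =>
    h (k : ℝ≥0∞)⁻¹ (ENNReal.inv_pos.2 (ENNReal.natCast_ne_top k))
  have (k : ℕ) : Countable (t k) := ht k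
  -- Each covering misses a null set, so keep the points covered at all scales `1 / k`.
  set B := A ∩ ⋂ k, ⋃ i ∈ t k, U k i
  have hAB : μH[d] (A \ B) = 0 := by
    rw [sdiff_self_inter, sdiff_iInter]
    exact measure_iUnion_null hnull
  calc μH[d] A = μH[d] B := (measure_eq_measure_of_null_sdiff inter_subset_left hAB).symm
    _ ≤ liminf (fun k => ∑' i : t k, ediam (U k i) ^ d) atTop := by
      refine Measure.hausdorffMeasure_le_liminf_tsum d B _ ENNReal.tendsto_inv_nat_nhds_zero
        (fun k (i : t k) => U k i) (.of_forall fun k i => hdiam k i i.2)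
        (.of_forall fun k => ?_)
      rw [← biUnion_eq_iUnion (t k) fun i _ => U k i]
      exact inter_subset_right.trans (iInter_subset _ k)
    _ ≤ M := liminf_le_of_le (by isBoundedDefault) fun b hb =>
      hb.exists.elim fun k hk => hk.trans (hsum k)

theorem exists_ediam_rpow_lt_mul_hausdorffMeasure_inter (hA : MeasurableSet A)
    (h0 : μH[d] A ≠ 0) (hfin : μH[d] A ≠ ∞) {c δ : ℝ≥0∞} (hc : 1 < c) (hδ : 0 < δ) :
    ∃ U : Set X, ediam U ≤ δ ∧ ediam U ^ d < c * μH[d] (A ∩ U) := by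
  by_contra! hcon
  have hle : c • (μH[d] : Measure X).restrict A ≤ μH[d] :=
    Measure.le_hausdorffMeasure d _ δ hδ fun s hs => by
      rw [Measure.smul_apply, Measure.restrict_apply' hA, smul_eq_mul, inter_comm]
      exact hcon s hs
  have hcA : c * μH[d] A ≤ 1 * μH[d] A := by
    simpa only [Measure.smul_apply, Measure.restrict_apply_self, smul_eq_mul, one_mul] using hle A
  exact (ENNReal.mul_lt_mul_left h0 hfin hc).not_ge hcA

end EMetricSpace

variable {X : Type*} [MetricSpace X] [SecondCountableTopology X] [MeasurableSpace X]
  {d : ℝ} {A E : Set X}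

theorem exists_closedBall_cover_tsum_ediam_rpow_le [OpensMeasurableSpace X]
    [HasBesicovitchCovering X] {ν : Measure X} [SFinite ν]
    (h : ∀ x ∈ A, ∃ᶠ r in 𝓝[>] 0, ediam (closedBall x r) ^ d ≤ ν (closedBall x r))
    {V : Set X} (hV : IsOpen V) (hAV : A ⊆ V) {δ : ℝ} (hδ : 0 < δ) :
    ∃ (t : Set X) (r : X → ℝ), t.Countable ∧ (∀ x ∈ t, r x ∈ Ioo 0 δ) ∧
      ν (A \ ⋃ x ∈ t, closedBall x (r x)) = 0 ∧
      ∑' x : t, ediam (closedBall (x : X) (r x)) ^ d ≤ ν V := by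
  have hsmall : ∀ x ∈ A, ∀ ε > 0, ({r | ediam (closedBall x r) ^ d ≤ ν (closedBall x r) ∧
      closedBall x r ⊆ V} ∩ Ioo 0 ε).Nonempty := fun x hx ε hε =>
    (((h x hx).and_eventually (nhdsWithin_le_nhds
      (eventually_closedBall_subset (hV.mem_nhds (hAV hx))))).and_eventually
      (Ioo_mem_nhdsGT hε)).exists
  obtain ⟨t, r, ht, -, hr, hnull, hdisj⟩ :=
    Besicovitch.exists_disjoint_closedBall_covering_ae ν _ A hsmall (fun _ => δ) fun _ _ => hδ
  refine ⟨t, r, ht, fun x hx => (hr x hx).2, hnull, ?_⟩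
  calc ∑' x : t, ediam (closedBall (x : X) (r x)) ^ d
      ≤ ∑' x : t, ν (closedBall (x : X) (r x)) := ENNReal.tsum_le_tsum fun x => (hr x x.2).1.1
    _ = ν (⋃ x ∈ t, closedBall x (r x)) :=
      (measure_biUnion ht hdisj fun _ _ => measurableSet_closedBall).symm
    _ ≤ ν V := measure_mono (iUnion₂_subset fun x hx => (hr x hx).1.2)

variable [BorelSpace X]

theorem hausdorffMeasure_le_of_frequently_ediam_rpow_le [HasBesicovitchCovering X]
    {ν : Measure X} [SFinite ν] [ν.OuterRegular] (hν : (μH[d] : Measure X).restrict A ≪ ν)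
    (h : ∀ x ∈ A, ∃ᶠ r in 𝓝[>] 0, ediam (closedBall x r) ^ d ≤ ν (closedBall x r)) :
    μH[d] A ≤ ν A := by
  rw [A.measure_eq_iInf_isOpen ν]
  refine le_iInf₂ fun V hAV => le_iInf fun hV => ?_
  refine hausdorffMeasure_le_of_forall_exists_cover (ι := X) fun δ hδ => ?_
  obtain ⟨ε, hε, hεδ⟩ : ∃ ε : ℝ, 0 < ε ∧ 2 * ENNReal.ofReal ε ≤ δ := by
    have hlim : Tendsto (fun ε => 2 * ENNReal.ofReal ε) (𝓝[>] 0) (𝓝 0) := by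
      refine tendsto_nhdsWithin_of_tendsto_nhds (Continuous.tendsto' ?_ _ _ (by simp))
      exact (ENNReal.continuous_const_mul ENNReal.ofNat_ne_top).comp ENNReal.continuous_ofReal
    exact (eventually_mem_nhdsWithin.and (hlim.eventually (ge_mem_nhds hδ))).exists
  obtain ⟨t, r, ht, hr, hnull, hsum⟩ :=
    exists_closedBall_cover_tsum_ediam_rpow_le h hV hAV hε
  refine ⟨t, fun x => closedBall x (r x), ht, fun x hx => ?_, ?_, hsum⟩
  · calc ediam (closedBall x (r x)) ≤ 2 * ENNReal.ofReal (r x) := by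
          rw [← closedEBall_ofReal (hr x hx).1.le]
          exact ediam_closedEBall_le
      _ ≤ 2 * ENNReal.ofReal ε := by gcongr; exact (hr x hx).2.le
      _ ≤ δ := hεδ
  · rw [← Measure.restrict_eq_self _ sdiff_subset]
    exact hν hnull

theorem ae_eventually_hausdorffMeasure_inter_closedBall_le [HasBesicovitchCovering X]
    (hd : 0 ≤ d) (hE : MeasurableSet E) (hfin : μH[d] E ≠ ∞) {c : ℝ≥0} (hc : 1 < c) :
    ∀ᵐ x ∂(μH[d] : Measure X).restrict E, ∀ᶠ r in 𝓝[>] 0,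
      μH[d] (E ∩ closedBall x r) ≤ c * (2 * ENNReal.ofReal r) ^ d := by
  have hc0 : c ≠ 0 := (zero_lt_one.trans hc).ne'
  have := isFiniteMeasure_restrict.2 hfin
  rw [ae_restrict_iff' hE]
  set A := {x | ¬ (x ∈ E → ∀ᶠ r in 𝓝[>] 0,
    μH[d] (E ∩ closedBall x r) ≤ c * (2 * ENNReal.ofReal r) ^ d)}
  have hAE : A ⊆ E := fun x hx => (Classical.not_imp.1 hx).1
  -- On the exceptional set `A` this measure dominates `μH[d]`, which a factor `c⁻¹ < 1` allows only
  -- for a null set.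
  let ν : Measure X := c⁻¹ • (μH[d] : Measure X).restrict E
  have hν (s : Set X) : ν s = (c : ℝ≥0∞)⁻¹ * μH[d] (E ∩ s) := by
    rw [Measure.coe_nnreal_smul_apply, ENNReal.coe_inv hc0, Measure.restrict_apply' hE, inter_comm]
  have hle : μH[d] A ≤ ν A := by
    refine hausdorffMeasure_le_of_frequently_ediam_rpow_le ?_ fun x hx => ?_
    · exact (Measure.restrict_mono hAE le_rfl).absolutelyContinuous.trans
        (Measure.absolutelyContinuous_smul (by simpa using hc0))
    · refine ((not_eventually.1 (Classical.not_imp.1 hx).2).and_eventually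
        self_mem_nhdsWithin).mono fun r ⟨hlt, hr⟩ => ?_
      rw [hν, ← closedEBall_ofReal (le_of_lt hr), ← ENNReal.div_eq_inv_mul]
      rw [ENNReal.le_div_iff_mul_le (by simp [hc0]) (by simp), mul_comm]
      rw [not_le, ← closedEBall_ofReal (le_of_lt hr)] at hlt
      refine le_trans ?_ hlt.le
      gcongr
      exact ediam_closedEBall_le
  rw [hν, inter_eq_right.2 hAE] at hle
  by_contra hne
  refine hle.not_gt ?_
  have hA : μH[d] A ≠ ∞ := measure_ne_top_of_subset hAE hfin
  have hcinv : (c : ℝ≥0∞)⁻¹ < 1 := ENNReal.inv_lt_one.2 (by exact_mod_cast hc)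
  exact (ENNReal.mul_lt_mul_left hne hA hcinv).trans_eq (one_mul _)

theorem exists_isCompact_subset_ediam_rpow_lt_mul_hausdorffMeasure [CompleteSpace X]
    (hd : 0 ≤ d) (hA : MeasurableSet A) (h0 : μH[d] A ≠ 0) (hfin : μH[d] A ≠ ∞) {c δ : ℝ≥0∞}
    (hc : 1 < c) (hδ : 0 < δ) :
    ∃ F ⊆ A, IsCompact F ∧ ediam F ≤ δ ∧ ediam F ^ d < c * μH[d] F := by
  obtain ⟨U, hUδ, hU⟩ := exists_ediam_rpow_lt_mul_hausdorffMeasure_inter hA h0 hfin hc hδ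
  have hlt : ediam U ^ d / c < μH[d] (A ∩ closure U) :=
    (ENNReal.div_lt_of_lt_mul' hU).trans_le (measure_mono (by gcongr; exact subset_closure))
  obtain ⟨F, hF, hFcomp, hltF⟩ := (hA.inter isClosed_closure.measurableSet)
    |>.exists_lt_isCompact_of_ne_top (measure_ne_top_of_subset inter_subset_left hfin) hlt
  have hFU : ediam F ≤ ediam U :=
    (ediam_mono (hF.trans inter_subset_right)).trans (ediam_closure U).le
  refine ⟨F, hF.trans inter_subset_left, hFcomp, hFU.trans hUδ, ?_⟩
  calc ediam F ^ d ≤ ediam U ^ d := by gcongr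
    _ < c * μH[d] F := by
      rw [mul_comm]
      exact (ENNReal.div_lt_iff (.inl (zero_lt_one.trans hc).ne') (.inr hU.ne_top)).1 hltF

end HausdorffDensity

section Localization

variable {X : Type*} [MeasurableSpace X]

theorem exists_measure_ne_zero_of_ae_eventually_nhdsGT
    {μ : Measure X} {S : ℝ → Set X} (hμ : μ ≠ 0) (h : ∀ᵐ x ∂μ, ∀ᶠ r in 𝓝[>] 0, x ∈ S r) :
    ∃ r > 0, μ (S r) ≠ 0 := by
  obtain ⟨u, -, hu_pos, hu⟩ := exists_seq_strictAnti_tendsto' (zero_lt_one' ℝ)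
  have hu' : Tendsto u atTop (𝓝[>] 0) :=
    tendsto_nhdsWithin_iff.2 ⟨hu, .of_forall fun k => (hu_pos k).1⟩
  have hcover : ∀ᵐ x ∂μ, x ∈ ⋃ k, S (u k) :=
    h.mono fun x hx => mem_iUnion.2 (hu'.eventually hx).exists
  by_contra! hnull
  have havoid : ∀ᵐ x ∂μ, x ∉ ⋃ k, S (u k) :=
    measure_eq_zero_iff_ae_notMem.1 (measure_iUnion_null fun k => hnull _ (hu_pos k).1)
  have hfalse : ∀ᵐ _ ∂μ, False := (hcover.and havoid).mono fun _ hx => hx.2 hx.1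
  exact hμ (ae_eq_bot.1 (eventually_false_iff_eq_bot.1 hfalse))

theorem isClosed_setOf_forall_measure_inter_closedBall_le [PseudoMetricSpace X]
    (μ : Measure X) (s : Set X) {g : ℝ → ℝ≥0∞} (hg : Continuous g) (δ : ℝ) :
    IsClosed {x | ∀ r ∈ Ioo 0 δ, μ (s ∩ closedBall x r) ≤ g r} := by
  refine isClosed_of_closure_subset fun x hx r hr => ?_
  obtain ⟨u, hu, hux⟩ := mem_closure_iff_seq_limit.1 hx
  have hradius : Tendsto (fun j => r + dist (u j) x) atTop (𝓝 r) := by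
    simpa only [add_zero] using (tendsto_iff_dist_tendsto_zero.1 hux).const_add r
  refine ge_of_tendsto ((hg.tendsto r).comp hradius) ?_
  filter_upwards [hradius.eventually (gt_mem_nhds hr.2)] with j hj
  refine (measure_mono (inter_subset_inter_right _ ?_)).trans
    (hu j _ ⟨add_pos_of_pos_of_nonneg hr.1 dist_nonneg, hj⟩)
  exact closedBall_subset_closedBall' (by rw [dist_comm])

theorem tendsto_setLIntegral_closedBall_nhdsGT [MetricSpace X] [OpensMeasurableSpace X]
    {μ : Measure X} [NullSingletonClass μ] {f : X → ℝ≥0∞} (hf : ∫⁻ y, f y ∂μ ≠ ∞) (x : X) :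
    Tendsto (fun r => ∫⁻ y in closedBall x r, f y ∂μ) (𝓝[>] 0) (𝓝 0) := by
  have := isFiniteMeasure_withDensity hf
  have hlim : Tendsto (fun r => μ.withDensity f (cthickening r {x})) (𝓝[>] 0)
      (𝓝 (μ.withDensity f {x})) :=
    (tendsto_measure_cthickening_of_isClosed ⟨1, one_pos, measure_ne_top _ _⟩
      isClosed_singleton).mono_left nhdsWithin_le_nhds
  rw [measure_singleton] at hlim
  refine hlim.congr' ?_
  filter_upwards [self_mem_nhdsWithin] with r hr
  rw [cthickening_singleton x (le_of_lt hr), withDensity_apply _ measurableSet_closedBall]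

theorem measurable_setLIntegral_closedBall [PseudoMetricSpace X] [SecondCountableTopology X]
    [OpensMeasurableSpace X] {μ : Measure X} [SFinite μ] {g : X → X → ℝ≥0∞}
    (hg : Measurable fun p : X × X => g p.1 p.2) (r : ℝ) :
    Measurable fun x => ∫⁻ y in closedBall x r, g x y ∂μ := by
  have hball : MeasurableSet {p : X × X | p.2 ∈ closedBall p.1 r} :=
    measurableSet_le (measurable_snd.dist measurable_fst) measurable_const
  simp_rw [← lintegral_indicator measurableSet_closedBall]
  exact (hg.indicator hball).lintegral_prod_right'

theorem measure_inter_closedBall_le_of_diam_lt [PseudoMetricSpace X] {μ : Measure X}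
    {F : Set X} (hF : Bornology.IsBounded F) (hpos : 0 < diam F) {δ : ℝ} (hδ : diam F < δ)
    {g : ℝ → ℝ≥0∞} (hg : Monotone g)
    (h : ∀ x ∈ F, ∀ r ∈ Ioo 0 δ, μ (F ∩ closedBall x r) ≤ g r) {x : X} (hx : x ∈ F)
    {r : ℝ} (hr : 0 < r) : μ (F ∩ closedBall x r) ≤ g r := by
  rcases lt_or_ge r δ with hrδ | hrδ
  · exact h x hx r ⟨hr, hrδ⟩
  · have hball : F ⊆ closedBall x (diam F) := fun y hy => dist_le_diam_of_mem hF hy hx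
    calc μ (F ∩ closedBall x r) ≤ μ (F ∩ closedBall x (diam F)) :=
          measure_mono (inter_subset_left.trans (subset_inter_iff.2 ⟨subset_rfl, hball⟩))
      _ ≤ g (diam F) := h x hx _ ⟨hpos, hδ⟩
      _ ≤ g r := hg (hδ.le.trans hrδ)

end Localization

section TamePoints

variable {X : Type*} [MetricSpace X] [MeasurableSpace X] [BorelSpace X] {g : X → X → ℝ≥0∞}
  {E F : Set X} {d : ℝ} {c : ℝ≥0} {ε : ℝ≥0∞} {δ : ℝ}

theorem diam_pos_of_hausdorffMeasure_ne_zero (hd : 0 < d) (hF : Bornology.IsBounded F)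
    (h : μH[d] F ≠ 0) : 0 < diam F := by
  have := Measure.nullSingletonClass_hausdorff X hd
  contrapose! h
  have hdiam : ediam F = 0 :=
    (ENNReal.toReal_eq_zero_iff _).1 (h.antisymm diam_nonneg) |>.resolve_right hF.ediam_ne_top
  exact (ediam_eq_zero_iff.1 hdiam).measure_zero _

/-- The points of `E` around which, at all scales below `δ`, the energy density of the kernel `g`
is at most `ε` and the `d`-dimensional density of `E` is at most `c`. For the energy it suffices
to consider the scale `δ`, by monotonicity. -/
def tamePoints (g : X → X → ℝ≥0∞) (E : Set X) (d : ℝ) (c : ℝ≥0) (ε : ℝ≥0∞) (δ : ℝ) : Set X :=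
  {x ∈ E | ∫⁻ y in closedBall x δ, g x y ∂(μH[d] : Measure X).restrict E ≤ ε ∧
    ∀ r ∈ Ioo 0 δ, μH[d] (E ∩ closedBall x r) ≤ c * (2 * ENNReal.ofReal r) ^ d}

theorem measurableSet_tamePoints [SecondCountableTopology X] (hE : MeasurableSet E)
    (hfin : μH[d] E ≠ ∞) (hg : Measurable fun p : X × X => g p.1 p.2) :
    MeasurableSet (tamePoints g E d c ε δ) := by
  have := isFiniteMeasure_restrict.2 hfin
  have hcont : Continuous fun r => (c : ℝ≥0∞) * (2 * ENNReal.ofReal r) ^ d :=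
    (ENNReal.continuous_const_mul ENNReal.coe_ne_top).comp <|
      ENNReal.continuous_rpow_const.comp <|
        (ENNReal.continuous_const_mul ENNReal.ofNat_ne_top).comp ENNReal.continuous_ofReal
  exact hE.inter <| (measurableSet_le (measurable_setLIntegral_closedBall hg δ)
    measurable_const).inter
      (isClosed_setOf_forall_measure_inter_closedBall_le _ E hcont δ).measurableSet

theorem exists_hausdorffMeasure_tamePoints_ne_zero [SecondCountableTopology X]
    [HasBesicovitchCovering X] (hd : 0 < d) (hE : MeasurableSet E) (h0 : μH[d] E ≠ 0)
    (hfin : μH[d] E ≠ ∞) (hg : Measurable fun p : X × X => g p.1 p.2)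
    (hgE : ∫⁻ x in E, ∫⁻ y in E, g x y ∂μH[d] ∂μH[d] ≠ ∞) (hc : 1 < c) (hε : ε ≠ 0) :
    ∃ δ > 0, μH[d] (tamePoints g E d c ε δ) ≠ 0 := by
  have := isFiniteMeasure_restrict.2 hfin
  have := Measure.nullSingletonClass_hausdorff X hd
  have hae : ∀ᵐ x ∂(μH[d] : Measure X).restrict E, ∀ᶠ δ in 𝓝[>] 0, x ∈ tamePoints g E d c ε δ := by
    filter_upwards [ae_restrict_mem hE, ae_lt_top hg.lintegral_prod_right' hgE,
      ae_eventually_hausdorffMeasure_inter_closedBall_le hd.le hE hfin hc] with x hx henergy hdens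
    obtain ⟨ρ, hρ, hdens⟩ := mem_nhdsGT_iff_exists_Ioo_subset.1 hdens
    filter_upwards [(tendsto_setLIntegral_closedBall_nhdsGT henergy.ne x).eventually
      (ge_mem_nhds hε.bot_lt), Ioo_mem_nhdsGT hρ] with δ hδ hδρ
    exact ⟨hx, hδ, fun r hr => hdens ⟨hr.1, hr.2.trans hδρ.2⟩⟩
  obtain ⟨δ, hδ, hpos⟩ := exists_measure_ne_zero_of_ae_eventually_nhdsGT
    (mt Measure.restrict_eq_zero.1 h0) hae
  exact ⟨δ, hδ, fun hnull =>
    hpos (Measure.absolutelyContinuous_of_le Measure.restrict_le_self hnull)⟩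

theorem hausdorffMeasure_inter_closedBall_le_of_subset_tamePoints (hd : 0 ≤ d)
    (hF : F ⊆ tamePoints g E d c ε δ) (hbdd : Bornology.IsBounded F) (hpos : 0 < diam F)
    (hδ : diam F < δ) {x : X} (hx : x ∈ F) {r : ℝ} (hr : 0 < r) :
    μH[d] (F ∩ closedBall x r) ≤ c * (2 * ENNReal.ofReal r) ^ d := by
  refine measure_inter_closedBall_le_of_diam_lt (g := fun r => c * (2 * ENNReal.ofReal r) ^ d)
    hbdd hpos hδ (fun r s hrs => ?_) (fun y hy s hs => ?_) hx hr
  · dsimp only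
    gcongr
  · have hFE : F ⊆ E := fun z hz => (hF hz).1
    exact (measure_mono (inter_subset_inter_left _ hFE)).trans ((hF hy).2.2 s hs)

theorem hausdorffMeasure_le_of_subset_tamePoints (hd : 0 ≤ d) (hF : F ⊆ tamePoints g E d c ε δ)
    (hbdd : Bornology.IsBounded F) (hpos : 0 < diam F) (hδ : diam F < δ) :
    μH[d] F ≤ c * (2 * ediam F) ^ d := by
  obtain ⟨x, hx⟩ : F.Nonempty := nonempty_iff_ne_empty.2 fun h => by simp [h] at hpos
  have hball : F ⊆ closedBall x (diam F) := fun y hy => dist_le_diam_of_mem hbdd hy hx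
  have hle := hausdorffMeasure_inter_closedBall_le_of_subset_tamePoints hd hF hbdd hpos hδ hx hpos
  rwa [inter_eq_left.2 hball, diam, ENNReal.ofReal_toReal hbdd.ediam_ne_top] at hle

theorem lintegral_lintegral_le_of_subset_tamePoints (hF : F ⊆ tamePoints g E d c ε δ)
    (hmeas : MeasurableSet F) (hbdd : Bornology.IsBounded F) (hδ : diam F ≤ δ) :
    ∫⁻ x in F, ∫⁻ y in F, g x y ∂μH[d] ∂μH[d] ≤ ε * μH[d] F := by
  have hinner (x : X) (hx : x ∈ F) : ∫⁻ y in F, g x y ∂μH[d] ≤ ε := by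
    have hball : F ⊆ closedBall x δ ∩ E := fun y hy =>
      ⟨(dist_le_diam_of_mem hbdd hy hx).trans hδ, (hF hy).1⟩
    calc ∫⁻ y in F, g x y ∂μH[d] ≤ ∫⁻ y in closedBall x δ ∩ E, g x y ∂μH[d] :=
          lintegral_mono_set hball
      _ = ∫⁻ y in closedBall x δ, g x y ∂(μH[d] : Measure X).restrict E := by
          rw [Measure.restrict_restrict measurableSet_closedBall]
      _ ≤ ε := (hF hx).2.1
  exact (setLIntegral_mono' hmeas hinner).trans_eq (setLIntegral_const F ε)

end TamePoints

section SmallEnergy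

variable {X : Type*} [MetricSpace X] [CompleteSpace X] [SecondCountableTopology X]
  [MeasurableSpace X] [BorelSpace X] [HasBesicovitchCovering X] {E : Set X} {d : ℝ} {c : ℝ≥0}
  {η : ℝ≥0∞}

theorem exists_isCompact_subset_lintegral_lintegral_le (hd : 0 < d) (hE : MeasurableSet E)
    (h0 : μH[d] E ≠ 0) (hfin : μH[d] E ≠ ∞) {g : X → X → ℝ≥0∞}
    (hg : Measurable fun p : X × X => g p.1 p.2)
    (hgE : ∫⁻ x in E, ∫⁻ y in E, g x y ∂μH[d] ∂μH[d] ≠ ∞) (hη : η ≠ 0) (hc : 1 < c) :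
    ∃ F ⊆ E, IsCompact F ∧
      ∫⁻ x in F, ∫⁻ y in F, g x y ∂μH[d] ∂μH[d] ≤ η * ediam F ^ d ∧
      ediam F ^ d < c * μH[d] F ∧
      ∀ x ∈ F, ∀ r > 0, μH[d] (F ∩ closedBall x r) ≤ c * (2 * ENNReal.ofReal r) ^ d := by
  set K : ℝ≥0∞ := c * 2 ^ d
  have hK0 : K ≠ 0 := mul_ne_zero (ENNReal.coe_ne_zero.2 (zero_lt_one.trans hc).ne')
    (ENNReal.rpow_pos two_pos ENNReal.ofNat_ne_top).ne'
  have hKtop : K ≠ ∞ := ENNReal.mul_ne_top ENNReal.coe_ne_top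
    (ENNReal.rpow_ne_top_of_nonneg hd.le ENNReal.ofNat_ne_top)
  obtain ⟨δ, hδ, hpos⟩ := exists_hausdorffMeasure_tamePoints_ne_zero hd hE h0 hfin hg hgE hc
    (ENNReal.div_ne_zero.2 ⟨hη, hKtop⟩)
  have htame : tamePoints g E d c (η / K) δ ⊆ E := fun x hx => hx.1
  obtain ⟨F, hF, hFcomp, hFδ, hFlt⟩ := exists_isCompact_subset_ediam_rpow_lt_mul_hausdorffMeasure
    hd.le (measurableSet_tamePoints hE hfin hg) hpos (measure_ne_top_of_subset htame hfin)
    (ENNReal.one_lt_coe_iff.2 hc) (ENNReal.ofReal_pos.2 (half_pos hδ))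
  have hbdd := hFcomp.isBounded
  have hdiam_lt : diam F < δ :=
    (ENNReal.toReal_le_of_le_ofReal (half_pos hδ).le hFδ).trans_lt (half_lt_self hδ)
  have hdiam_pos : 0 < diam F := diam_pos_of_hausdorffMeasure_ne_zero hd hbdd fun h => by
    simp [h] at hFlt
  refine ⟨F, hF.trans htame, hFcomp, ?_, hFlt, fun x hx r hr =>
    hausdorffMeasure_inter_closedBall_le_of_subset_tamePoints hd.le hF hbdd hdiam_pos hdiam_lt
      hx hr⟩
  calc ∫⁻ x in F, ∫⁻ y in F, g x y ∂μH[d] ∂μH[d] ≤ η / K * μH[d] F :=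
        lintegral_lintegral_le_of_subset_tamePoints hF hFcomp.measurableSet hbdd hdiam_lt.le
    _ ≤ η / K * (c * (2 * ediam F) ^ d) := by
        gcongr
        exact hausdorffMeasure_le_of_subset_tamePoints hd.le hF hbdd hdiam_pos hdiam_lt
    _ = η / K * K * ediam F ^ d := by
        rw [ENNReal.mul_rpow_of_nonneg _ _ hd.le]
        ring
    _ = η * ediam F ^ d := by rw [ENNReal.div_mul_cancel hK0 hKtop]

theorem proposition1p1_general (hd : 0 < d) (hE : MeasurableSet E) (h0 : μH[d] E ≠ 0)
    (hfin : μH[d] E ≠ ∞) {κ : X → X → X → ℝ≥0∞}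
    (hκ : Measurable fun p : X × X × X => κ p.1 p.2.1 p.2.2)
    (hκE : ∫⁻ x in E, ∫⁻ y in E, ∫⁻ z in E, κ x y z ∂μH[d] ∂μH[d] ∂μH[d] ≠ ∞) (hη : η ≠ 0)
    (hc : 1 < c) :
    ∃ F ⊆ E, IsCompact F ∧
      ∫⁻ x in F, ∫⁻ y in F, ∫⁻ z in F, κ x y z ∂μH[d] ∂μH[d] ∂μH[d] ≤ η * ediam F ^ d ∧
      ediam F ^ d < c * μH[d] F ∧
      ∀ x ∈ F, ∀ r > 0, μH[d] (F ∩ closedBall x r) ≤ c * (2 * ENNReal.ofReal r) ^ d := by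
  have := isFiniteMeasure_restrict.2 hfin
  have hg : Measurable fun p : X × X => ∫⁻ z in E, κ p.1 p.2 z ∂μH[d] :=
    Measurable.lintegral_prod_right' (f := fun p : (X × X) × X => κ p.1.1 p.1.2 p.2)
      (hκ.comp MeasurableEquiv.prodAssoc.measurable)
  obtain ⟨F, hFE, hF, henergy, hlower, hupper⟩ :=
    exists_isCompact_subset_lintegral_lintegral_le hd hE h0 hfin hg hκE hη hc
  refine ⟨F, hFE, hF, le_trans ?_ henergy, hlower, hupper⟩
  exact lintegral_mono fun x => lintegral_mono fun y => lintegral_mono_set hFE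

end SmallEnergy

theorem proposition1p1 (n : ℕ) (E : Set (EuclideanSpace ℝ (Fin n)))
    (hE : IsOneSet E) (hc : totalMengerCurvatureSq E < ∞) (η : ℝ) (hη : 0 < η) :
    ∃ F : Set (EuclideanSpace ℝ (Fin n)), F ⊆ E ∧
      IsCompact F ∧
      totalMengerCurvatureSq F ≤ ENNReal.ofReal (η * Metric.diam F) ∧
      ENNReal.ofReal (Metric.diam F / 40) < Measure.hausdorffMeasure 1 F ∧
      ∀ x ∈ F, ∀ t : ℝ, 0 < t →
        Measure.hausdorffMeasure 1 (F ∩ Metric.closedBall x t) ≤ ENNReal.ofReal (3 * t) := by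
  -- With `c = 3 / 2` the growth bound `c * (2 * t)` is `3 * t`.
  obtain ⟨F, hFE, hF, hcurv, hlower, hupper⟩ := proposition1p1_general
    (c := Real.toNNReal (3 / 2)) one_pos hE.measurableSet hE.hausdorffMeasure_pos.ne'
    hE.hausdorffMeasure_lt_top.ne (measurable_mengerCurvature.pow_const 2).ennreal_ofReal hc.ne
    (ENNReal.ofReal_pos.2 hη).ne' (Real.one_lt_toNNReal.2 (by norm_num))
  have hdiam : ediam F = ENNReal.ofReal (diam F) :=
    (ENNReal.ofReal_toReal hF.isBounded.ediam_ne_top).symm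
  simp only [ENNReal.rpow_one, hdiam, ENNReal.ofNNReal_toNNReal] at hcurv hlower hupper
  refine ⟨F, hFE, hF, ?_, ?_, fun x hx t ht => (hupper x hx t ht).trans_eq ?_⟩
  · rwa [ENNReal.ofReal_mul hη.le]
  · calc ENNReal.ofReal (diam F / 40) ≤ ENNReal.ofReal (diam F / (3 / 2)) := by
          gcongr
          norm_num
      _ = ENNReal.ofReal (diam F) / ENNReal.ofReal (3 / 2) :=
          ENNReal.ofReal_div_of_pos (by norm_num)
      _ < μH[1] F := ENNReal.div_lt_of_lt_mul' hlower
  · rw [← ENNReal.ofReal_ofNat 2, ← ENNReal.ofReal_mul zero_le_two,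
      ← ENNReal.ofReal_mul (by norm_num)]
    ring_nf
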